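/- Let $X_1,\dots,X_d$ be Hermitian $n\times n$ complex matrices that are linearly independent over $\mathbb R$ and whose real span does not contain the identity matrix $I$. For $\theta\in\mathbb R^d$ put $$\mu(\theta)=\log\operatorname{Tr}\exp\Big(\sum_{j=1}^d\theta^jX_j\Big),\qquad \rho_\theta=\exp\Big(\sum_{j=1}^d\theta^jX_j-\mu(\theta)I\Big).$$ For a function $F$ on $\mathbb R^d$ let $D^F(\theta\|\theta')=\sum_i\partial_iF(\theta)(\theta^i-\theta'^i)-F(\theta)+F(\theta')$ be its Bregman divergence. For linearly independent $v_1,\dots,v_l\in\mathbb R^d$ and $\theta_0\in\mathbb R^d$ let $\mu_{\theta_0}(\tau)=\mu(\theta_0+\sum_{j=1}^l\tau^jv_j)$ for $\tau\in\mathbb R^l$, and let $$\Xi(\theta_0;v)=\big\{(\partial_j\mu_{\theta_0}(\tau))_{j=1}^l:\tau\in\mathbb R^l\big\}$$ be the set of mixture (mean) parameters of the exponential subfamily generated by $v_1,\dots,v_l$ at $\theta_0$. For $a\in\mathbb R^l$ let $\mathcal M(a)=\{\theta\in\mathbb R^d:\sum_iv_j^i\,\partial_i\mu(\theta)=a_j,\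 j=1,\dots,l\}$ and, for $u_1,\dots,u_{d-l}$ completing $v_1,\dots,v_l$ to a basis of $\mathbb R^d$, let $\Theta_u(a)\subset\mathbb R^{d-l}$ be the set of all $\tau$ for which there is $\sigma\in\mathbb R^l$ with $\sum_i\tau^iu_i+\sum_j\sigma^jv_j\in\mathcal M(a)$. Then: 1. $\mu$ is $C^\infty$ and strictly convex on $\mathbb R^d$, and its Bregman divergence is the quantum relative entropy: $D^\mu(\theta\|\theta')=\operatorname{Tr}\rho_\theta(\log\rho_\theta-\log\rho_{\theta'})$ for all $\theta,\theta'\in\mathbb R^d$. 2. (E4) For all $1\le l\le d-1$, all linearly independent $v_1,\dots,v_l$ and all completing $u_1,\dots,u_{d-l}$, the set $\Theta_u(a)$ is the same for all $a\in\mathbb R^l$ with $\mathcal M(a)\ne\emptyset$. 3. (M4) For all $1\le l\le d-1$ and all linearly independent $v_1,\dots,v_l$, the set $\Xi(\theta_0;v)$ does not depend on $\theta_0\in\mathbb R^d$. 4. $\partial_j\mu(\theta)=\operatorname{Tr}\rho_\theta X_j$ for all $\theta\in\mathbb R^d$ and $1\le j\le d$, and for every $\theta_0\in\mathbb R^d$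 and all linearly independent $v_1,\dots,v_l\in\mathbb R^d$, with $Y_j=\sum_iv_j^iX_i$, $$\Xi(\theta_0;v)=\operatorname{int}\,\operatorname{conv}\big\{(\operatorname{Tr}\rho Y_j)_{j=1}^l:\rho\text{ a pure state}\big\},$$ where a pure state is a matrix $\psi\psi^*$ with $\psi\in\mathbb C^n$, $\|\psi\|=1$. -/

import Mathlib

open scoped ContDiff

noncomputable section

namespace Bregman

variable {d l k n : ℕ}

/-- The partial derivative `∂_i F (θ)` of a function on `ℝ^d`. -/
def partialDeriv (F : (Fin d → ℝ) → ℝ) (i : Fin d) (θ : Fin d → ℝ) : ℝ :=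
  fderiv ℝ F θ (Pi.single i 1)

/-- The Bregman divergence
`D^F(θ₁ ‖ θ₂) = ⟨∇F(θ₁), θ₁ - θ₂⟩ - F(θ₁) + F(θ₂)`. -/
def divergence (F : (Fin d → ℝ) → ℝ) (θ₁ θ₂ : Fin d → ℝ) : ℝ :=
  ∑ i, partialDeriv F i θ₁ * (θ₁ i - θ₂ i) - F θ₁ + F θ₂

/-- `(Θ, F, D)` is a Bregman divergence system: `Θ ⊆ ℝ^d` is open and convex, `F` is a
strictly convex `C^∞` function on `Θ` and `D` is the Bregman divergence of `F` on `Θ`. -/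
structure IsSystem (Θ : Set (Fin d → ℝ)) (F : (Fin d → ℝ) → ℝ)
    (D : (Fin d → ℝ) → (Fin d → ℝ) → ℝ) : Prop where
  isOpen : IsOpen Θ
  convex : Convex ℝ Θ
  smooth : ContDiffOn ℝ ∞ F Θ
  strictConvex : StrictConvexOn ℝ Θ F
  divergence_eq : ∀ θ₁ ∈ Θ, ∀ θ₂ ∈ Θ, D θ₁ θ₂ = divergence F θ₁ θ₂

/-! ### Exponential subfamilies -/

/-- The parametrization `τ ↦ θ₀ + ∑ j, τ^j v_j` of the exponential subfamily generated by
`v_1, …, v_l` at `θ₀`. -/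
def expParam (θ₀ : Fin d → ℝ) (v : Fin l → Fin d → ℝ) (τ : Fin l → ℝ) : Fin d → ℝ :=
  θ₀ + ∑ j, τ j • v j

/-- The set `Θ_E` of natural parameters of the exponential subfamily. -/
def expNaturalSet (Θ : Set (Fin d → ℝ)) (θ₀ : Fin d → ℝ) (v : Fin l → Fin d → ℝ) :
    Set (Fin l → ℝ) :=
  {τ | expParam θ₀ v τ ∈ Θ}

/-- The restricted potential `F_E` of the exponential subfamily. -/
def expPotential (F : (Fin d → ℝ) → ℝ) (θ₀ : Fin d → ℝ) (v : Fin l → Fin d → ℝ)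
    (τ : Fin l → ℝ) : ℝ :=
  F (expParam θ₀ v τ)

/-- The set `Ξ_E` of mixture parameters `(∂_j F_E(τ))_j`, `τ ∈ Θ_E`, of the exponential
subfamily. -/
def expMixtureSet (Θ : Set (Fin d → ℝ)) (F : (Fin d → ℝ) → ℝ) (θ₀ : Fin d → ℝ)
    (v : Fin l → Fin d → ℝ) : Set (Fin l → ℝ) :=
  (fun τ j => partialDeriv (expPotential F θ₀ v) j τ) '' expNaturalSet Θ θ₀ v

/-! ### Mixture subfamilies -/

/-- The mixture subfamily `M(a_1, …, a_l)` generated by the constraints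
`∑ i, v_j^i ∂_i F(θ) = a_j`. -/
def mixtureFamily (Θ : Set (Fin d → ℝ)) (F : (Fin d → ℝ) → ℝ) (v : Fin l → Fin d → ℝ)
    (a : Fin l → ℝ) : Set (Fin d → ℝ) :=
  {θ | θ ∈ Θ ∧ ∀ j, ∑ i, v j i * partialDeriv F i θ = a j}

/-- The parameter set `Θ_M` of the mixture subfamily `M(a)` with respect to the basis
`u_1, …, u_k, v_1, …, v_l` of `ℝ^d`: the first `k` coordinates, in this basis, of the points of
`M(a)`. -/
def mixtureNaturalSet (Θ : Set (Fin d → ℝ)) (F : (Fin d → ℝ) → ℝ) (u : Fin k → Fin d → ℝ)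
    (v : Fin l → Fin d → ℝ) (a : Fin l → ℝ) : Set (Fin k → ℝ) :=
  {τ | ∃ σ : Fin l → ℝ, ∑ i, τ i • u i + ∑ j, σ j • v j ∈ mixtureFamily Θ F v a}

/-! ### The conditions on a Bregman divergence system -/

/-- Condition (M3) for `v_1, …, v_l`: the set of mixture parameters of the exponential
subfamily generated by `v_1, …, v_l` at `θ₀` does not depend on `θ₀ ∈ Θ`. -/
def CondM3 (Θ : Set (Fin d → ℝ)) (F : (Fin d → ℝ) → ℝ) (v : Fin l → Fin d → ℝ) : Prop :=
  ∀ θ₀ ∈ Θ, ∀ θ₁ ∈ Θ, expMixtureSet Θ F θ₀ v = expMixtureSet Θ F θ₁ v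

/-- Condition (E3) for `v_1, …, v_l`: for every completion of `v_1, …, v_l` to a basis by
vectors `u_1, …, u_{d-l}`, the `(d-l)`-dimensional parameter set of the mixture subfamily
`M(a)` does not depend on `a`, as long as `M(a)` is nonempty. -/
def CondE3 (Θ : Set (Fin d → ℝ)) (F : (Fin d → ℝ) → ℝ) (v : Fin l → Fin d → ℝ) : Prop :=
  ∀ u : Fin (d - l) → Fin d → ℝ, LinearIndependent ℝ (Sum.elim u v) →
    ∀ a b : Fin l → ℝ, (mixtureFamily Θ F v a).Nonempty → (mixtureFamily Θ F v b).Nonempty →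
      mixtureNaturalSet Θ F u v a = mixtureNaturalSet Θ F u v b

/-- Condition (M4): (M3) holds for all linearly independent `v_1, …, v_l`, `1 ≤ l ≤ d - 1`. -/
def CondM4 (Θ : Set (Fin d → ℝ)) (F : (Fin d → ℝ) → ℝ) : Prop :=
  ∀ l : ℕ, 1 ≤ l → l < d → ∀ v : Fin l → Fin d → ℝ, LinearIndependent ℝ v → CondM3 Θ F v

/-- Condition (E4): (E3) holds for all linearly independent `v_1, …, v_l`, `1 ≤ l ≤ d - 1`. -/
def CondE4 (Θ : Set (Fin d → ℝ)) (F : (Fin d → ℝ) → ℝ) : Prop :=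
  ∀ l : ℕ, 1 ≤ l → l < d → ∀ v : Fin l → Fin d → ℝ, LinearIndependent ℝ v → CondE3 Θ F v

/-! ### The quantum system

Traces of products of two Hermitian matrices are real; the real part below only turns them into
real numbers. -/

/-- `μ(θ) = log Tr exp (∑ j, θ^j X_j)`. -/
def quantumPotential (X : Fin d → Matrix (Fin n) (Fin n) ℂ) (θ : Fin d → ℝ) : ℝ :=
  Real.log (NormedSpace.exp (∑ j, θ j • X j)).trace.re

/-- `ρ_θ = exp (∑ j, θ^j X_j - μ(θ) I)`. -/
def quantumState (X : Fin d → Matrix (Fin n) (Fin n) ℂ) (θ : Fin d → ℝ) :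
    Matrix (Fin n) (Fin n) ℂ :=
  NormedSpace.exp (∑ j, θ j • X j - quantumPotential X θ • (1 : Matrix (Fin n) (Fin n) ℂ))

/-- The quantum relative entropy `D(ρ ‖ σ) = Tr ρ (log ρ - log σ)` of positive definite
density matrices; the logarithm is taken by functional calculus. -/
def relativeEntropy (ρ σ : Matrix (Fin n) (Fin n) ℂ) : ℝ :=
  (ρ * (cfc Real.log ρ - cfc Real.log σ)).trace.re

/-- Pure states: the rank-one projections `|ψ⟩⟨ψ|` for unit vectors `ψ`. -/
def IsPureState (ρ : Matrix (Fin n) (Fin n) ℂ) : Prop :=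
  ∃ ψ : Fin n → ℂ, dotProduct (star ψ) ψ = 1 ∧ ρ = Matrix.vecMulVec ψ (star ψ)

/-- The set of expectation vectors `(Tr ρ Y_j)_j` over all pure states `ρ`. -/
def pureExpectations (Y : Fin l → Matrix (Fin n) (Fin n) ℂ) : Set (Fin l → ℝ) :=
  (fun ρ j => (ρ * Y j).trace.re) '' {ρ | IsPureState ρ}

end Bregman

end

/-! Everything rests on Klein's inequality Tr e^A + Tr e^A (B - A) ≤ Tr e^B, with equality only for
A = B. In eigenbases of A and B it is a weighted sum of scalar tangent inequalities for exp. Applied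
to normalized exponents it becomes the gradient inequality of log Tr exp. Its linear term identifies
∂_j μ with Tr ρ_θ X_j. Its equality case forces the difference of exponents to be a multiple of I,
so independence and I ∉ span give strict convexity. The relative entropy formula follows because log
ρ_θ is the exponent of ρ_θ.

For mean parameters (`expMixtureSet_quantumPotential`), one inclusion holds because a Gibbs state is
a mixture of pure states and a strictly convex differentiable function has an open gradient range.
For the other, Jensen's inequality bounds the potential below by τ·x minus a constant, uniformly for
x in the convex hull. Hence F - ξ·τ is coercive for ξ interior to the hull, and its minimizer has
gradient ξ. The description does not involve θ₀, which is (M3). In turn (M3) makes every Θ_u(a) with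
M(a) nonempty the whole space, which is (E3). -/

open scoped ContDiff

noncomputable section

namespace Bregman

/-! ### Spectral form of Hermitian matrices. -/

section Matrix

variable {m : Type*} [Fintype m] [DecidableEq m]

/-- The matrix with eigenvalues `f i` and eigenvectors the columns of `U`. -/
def conjDiag (U : Matrix m m ℂ) (f : m → ℝ) : Matrix m m ℂ :=
  U * Matrix.diagonal (fun i => (f i : ℂ)) * star U

section conjDiag

variable {U V : Matrix m m ℂ}

theorem conjDiag_mul (hU : U ∈ Matrix.unitaryGroup m ℂ) (f g : m → ℝ) :
    conjDiag U f * conjDiag U g = conjDiag U (fun i => f i * g i) := by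
  have h : star U * U = 1 := Unitary.star_mul_self_of_mem hU
  calc conjDiag U f * conjDiag U g
      = U * Matrix.diagonal (fun i => (f i : ℂ)) * (star U * U) *
          Matrix.diagonal (fun i => (g i : ℂ)) * star U := by
        simp only [conjDiag, Matrix.mul_assoc]
    _ = _ := by
        rw [h, Matrix.mul_one, Matrix.mul_assoc U, Matrix.diagonal_mul_diagonal]
        simp [conjDiag]

theorem conjDiag_sub_const (hU : U ∈ Matrix.unitaryGroup m ℂ) (f : m → ℝ) (c : ℝ) :
    conjDiag U f - c • (1 : Matrix m m ℂ) = conjDiag U (fun i => f i - c) := by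
  have h : U * star U = 1 := Unitary.mul_star_self_of_mem hU
  have h2 : (Matrix.diagonal (fun i => ((f i - c : ℝ) : ℂ)) : Matrix m m ℂ) =
      Matrix.diagonal (fun i => (f i : ℂ)) - c • (1 : Matrix m m ℂ) := by
    ext i j
    by_cases hij : i = j <;> simp [Matrix.diagonal, hij]
  rw [conjDiag, conjDiag, h2, Matrix.mul_sub, Matrix.sub_mul, Matrix.mul_smul, Matrix.smul_mul,
    Matrix.mul_one, h]

theorem conjDiag_one (hU : U ∈ Matrix.unitaryGroup m ℂ) :
    conjDiag U (fun _ => 1) = 1 := by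
  simpa [conjDiag] using Unitary.mul_star_self_of_mem hU

theorem exp_conjDiag (hU : U ∈ Matrix.unitaryGroup m ℂ) (f : m → ℝ) :
    NormedSpace.exp (conjDiag U f) = conjDiag U (fun i => Real.exp (f i)) := by
  have h : U * star U = 1 := Unitary.mul_star_self_of_mem hU
  have hinv : star U = U⁻¹ := (Matrix.inv_eq_right_inv h).symm
  rw [conjDiag, conjDiag, hinv, Matrix.exp_conj _ _ (IsUnit.of_mul_eq_one _ h),
    Matrix.exp_diagonal]
  congr 3
  ext i
  rw [Pi.coe_exp, ← Complex.exp_eq_exp_ℂ, Complex.ofReal_exp]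

theorem _root_.Matrix.IsHermitian.exists_eq_conjDiag {A : Matrix m m ℂ} (hA : A.IsHermitian) :
    ∃ U ∈ Matrix.unitaryGroup m ℂ, ∃ a : m → ℝ, A = conjDiag U a := by
  refine ⟨hA.eigenvectorUnitary, hA.eigenvectorUnitary.2, hA.eigenvalues, ?_⟩
  conv_lhs => rw [hA.spectral_theorem, Unitary.conjStarAlgAut_apply]
  rfl

/-- The weights are the squared overlaps of the two eigenbases when U and V are unitary. This
reduces trace inequalities between non-commuting matrices to scalar ones. -/
theorem trace_conjDiag_mul_conjDiag (f g : m → ℝ) :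
    (conjDiag U f * conjDiag V g).trace =
      ((∑ i, ∑ j, f i * g j * Complex.normSq ((star U * V) i j) : ℝ) : ℂ) := by
  have h : (conjDiag U f * conjDiag V g).trace =
      (Matrix.diagonal (fun i => (f i : ℂ)) * (star U * V) *
        (Matrix.diagonal (fun i => (g i : ℂ)) * star (star U * V))).trace := by
    rw [conjDiag, Matrix.mul_assoc, Matrix.mul_assoc, Matrix.trace_mul_comm, star_mul, star_star]
    simp only [conjDiag, Matrix.mul_assoc]
  rw [h]
  push_cast
  refine Finset.sum_congr rfl fun i _ => ?_
  rw [Matrix.diag_apply, Matrix.mul_apply]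
  refine Finset.sum_congr rfl fun j _ => ?_
  rw [Matrix.diagonal_mul, Matrix.diagonal_mul, Matrix.star_apply, Complex.normSq_eq_conj_mul_self]
  simp only [RCLike.star_def]
  ring

theorem trace_conjDiag (hU : U ∈ Matrix.unitaryGroup m ℂ) (f : m → ℝ) :
    (conjDiag U f).trace = ((∑ i, f i : ℝ) : ℂ) := by
  rw [conjDiag, Matrix.trace_mul_comm, ← Matrix.mul_assoc, Unitary.star_mul_self_of_mem hU,
    Matrix.one_mul, Matrix.trace_diagonal]
  push_cast
  rfl

theorem conjDiag_eq_sum (f : m → ℝ) :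
    conjDiag U f = ∑ i, f i • Matrix.vecMulVec (fun k => U k i) (star fun k => U k i) := by
  ext k j
  rw [conjDiag, Matrix.mul_apply, Matrix.sum_apply]
  refine Finset.sum_congr rfl fun i _ => ?_
  simp [Matrix.mul_diagonal, Matrix.vecMulVec_apply, Matrix.star_apply]
  ring

theorem trace_vecMulVec_mul_conjDiag (ψ : m → ℂ) (f : m → ℝ) :
    (Matrix.vecMulVec ψ (star ψ) * conjDiag U f).trace =
      ((∑ i, f i * Complex.normSq ((star U).mulVec ψ i) : ℝ) : ℂ) := by
  rw [Matrix.trace_mul_comm, Matrix.mul_vecMulVec, Matrix.trace_vecMulVec, conjDiag,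
    ← Matrix.mulVec_mulVec, ← Matrix.mulVec_mulVec, dotProduct_comm,
    Matrix.dotProduct_mulVec]
  have h : Matrix.vecMul (star ψ) U = star ((star U).mulVec ψ) := by
    rw [Matrix.star_mulVec, Matrix.star_eq_conjTranspose, Matrix.conjTranspose_conjTranspose]
  rw [h, dotProduct]
  push_cast
  refine Finset.sum_congr rfl fun i _ => ?_
  rw [Matrix.mulVec_diagonal, Complex.normSq_eq_conj_mul_self]
  simp only [Pi.star_apply, RCLike.star_def]
  ring

end conjDiag

/-! ### Trace inequalities -/

theorem exp_tangent_le (a b : ℝ) : Real.exp a + Real.exp a * (b - a) ≤ Real.exp b := by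
  have h := Real.add_one_le_exp (b - a)
  have h2 : Real.exp b = Real.exp a * Real.exp (b - a) := by rw [← Real.exp_add]; ring_nf
  nlinarith [Real.exp_pos a]

theorem eq_of_exp_tangent_eq {a b : ℝ}
    (h : Real.exp b - (Real.exp a + Real.exp a * (b - a)) = 0) : a = b := by
  by_contra hab
  have h1 := Real.add_one_lt_exp (sub_ne_zero.2 (Ne.symm hab))
  have h2 : Real.exp b = Real.exp a * Real.exp (b - a) := by rw [← Real.exp_add]; ring_nf
  nlinarith [Real.exp_pos a]

/-- Klein's inequality for the exponential, with its case of equality. -/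
theorem klein_inequality {A B : Matrix m m ℂ} (hA : A.IsHermitian) (hB : B.IsHermitian) :
    (NormedSpace.exp A).trace.re + (NormedSpace.exp A * (B - A)).trace.re ≤
        (NormedSpace.exp B).trace.re ∧
      ((NormedSpace.exp A).trace.re + (NormedSpace.exp A * (B - A)).trace.re =
        (NormedSpace.exp B).trace.re → A = B) := by
  obtain ⟨U, hU, a, rfl⟩ := hA.exists_eq_conjDiag
  obtain ⟨V, hV, b, rfl⟩ := hB.exists_eq_conjDiag
  set w : m → m → ℝ := fun i j => Complex.normSq ((star U * V) i j) with hw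
  -- Inserting 1, diagonalized in the other basis, writes each single trace as a double sum with the
  -- same weights w.
  have e1 : (NormedSpace.exp (conjDiag U a)).trace.re = ∑ i, ∑ j, Real.exp (a i) * 1 * w i j := by
    rw [exp_conjDiag hU, ← Matrix.mul_one (conjDiag U _), ← conjDiag_one hV,
      trace_conjDiag_mul_conjDiag, Complex.ofReal_re]
  have e2 : (NormedSpace.exp (conjDiag V b)).trace.re = ∑ i, ∑ j, 1 * Real.exp (b j) * w i j := by
    rw [exp_conjDiag hV, ← Matrix.one_mul (conjDiag V _), ← conjDiag_one hU,
      trace_conjDiag_mul_conjDiag, Complex.ofReal_re]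
  have e3 : (NormedSpace.exp (conjDiag U a) * conjDiag V b).trace.re =
      ∑ i, ∑ j, Real.exp (a i) * b j * w i j := by
    rw [exp_conjDiag hU, trace_conjDiag_mul_conjDiag, Complex.ofReal_re]
  have e4 : (NormedSpace.exp (conjDiag U a) * conjDiag U a).trace.re =
      ∑ i, ∑ j, Real.exp (a i) * a i * 1 * w i j := by
    rw [exp_conjDiag hU, conjDiag_mul hU, ← Matrix.mul_one (conjDiag U _), ← conjDiag_one hV,
      trace_conjDiag_mul_conjDiag, Complex.ofReal_re]
  have key : (NormedSpace.exp (conjDiag V b)).trace.re -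
      ((NormedSpace.exp (conjDiag U a)).trace.re +
        (NormedSpace.exp (conjDiag U a) * (conjDiag V b - conjDiag U a)).trace.re) =
      ∑ i, ∑ j, (Real.exp (b j) - (Real.exp (a i) + Real.exp (a i) * (b j - a i))) * w i j := by
    rw [Matrix.mul_sub, Matrix.trace_sub, Complex.sub_re, e1, e2, e3, e4]
    simp only [← Finset.sum_add_distrib, ← Finset.sum_sub_distrib]
    refine Finset.sum_congr rfl fun i _ => Finset.sum_congr rfl fun j _ => ?_
    ring
  have hnn : ∀ i j,
      0 ≤ (Real.exp (b j) - (Real.exp (a i) + Real.exp (a i) * (b j - a i))) * w i j :=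
    fun i j => mul_nonneg (sub_nonneg.2 (exp_tangent_le _ _)) (Complex.normSq_nonneg _)
  refine ⟨?_, fun heq => ?_⟩
  · have := Finset.sum_nonneg fun i (_ : i ∈ Finset.univ) =>
      Finset.sum_nonneg fun j (_ : j ∈ Finset.univ) => hnn i j
    linarith
  · rw [heq, sub_self] at key
    have hz : ∀ i j, a i = b j ∨ (star U * V) i j = 0 := by
      intro i j
      have h1 := (Finset.sum_eq_zero_iff_of_nonneg (fun i _ =>
        Finset.sum_nonneg fun j _ => hnn i j)).1 key.symm i (Finset.mem_univ _)
      have h2 := (Finset.sum_eq_zero_iff_of_nonneg (fun j _ => hnn i j)).1 h1 j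
        (Finset.mem_univ _)
      rcases mul_eq_zero.1 h2 with h | h
      · exact Or.inl (eq_of_exp_tangent_eq h)
      · exact Or.inr (Complex.normSq_eq_zero.1 h)
    -- Wherever the overlap is nonzero the eigenvalues agree, so U*V intertwines the two diagonal
    -- matrices; undoing the conjugation gives A = B.
    have hcomm : Matrix.diagonal (fun i => (a i : ℂ)) * (star U * V) =
        (star U * V) * Matrix.diagonal (fun i => (b i : ℂ)) := by
      ext i j
      rw [Matrix.diagonal_mul, Matrix.mul_diagonal]
      rcases hz i j with h | h
      · rw [h, mul_comm]
      · rw [h, mul_zero, zero_mul]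
    have hUU : U * star U = 1 := Unitary.mul_star_self_of_mem hU
    have hVV : V * star V = 1 := Unitary.mul_star_self_of_mem hV
    calc conjDiag U a
        = U * (Matrix.diagonal (fun i => (a i : ℂ)) * (star U * V)) * star V := by
          rw [conjDiag, Matrix.mul_assoc _ _ (star V), Matrix.mul_assoc _ _ (star V),
            Matrix.mul_assoc _ _ (star V), hVV, Matrix.mul_one, Matrix.mul_assoc]
      _ = (U * star U) * V * Matrix.diagonal (fun i => (b i : ℂ)) * star V := by
          rw [hcomm]
          simp only [Matrix.mul_assoc]
      _ = conjDiag V b := by rw [hUU, Matrix.one_mul, conjDiag]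

theorem trace_exp_pos [Nonempty m] {A : Matrix m m ℂ} (hA : A.IsHermitian) :
    0 < (NormedSpace.exp A).trace.re := by
  obtain ⟨U, hU, a, rfl⟩ := hA.exists_eq_conjDiag
  rw [exp_conjDiag hU, trace_conjDiag hU, Complex.ofReal_re]
  exact Finset.sum_pos (fun i _ => Real.exp_pos _) Finset.univ_nonempty

theorem exp_sub_const {A : Matrix m m ℂ} (hA : A.IsHermitian) (c : ℝ) :
    NormedSpace.exp (A - c • (1 : Matrix m m ℂ)) = Real.exp (-c) • NormedSpace.exp A := by
  obtain ⟨U, hU, a, rfl⟩ := hA.exists_eq_conjDiag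
  rw [conjDiag_sub_const hU, exp_conjDiag hU, exp_conjDiag hU, conjDiag_eq_sum, conjDiag_eq_sum,
    Finset.smul_sum]
  refine Finset.sum_congr rfl fun i _ => ?_
  rw [smul_smul, ← Real.exp_add, neg_add_eq_sub]

/-! ### The log-partition function and Gibbs states. -/

/-- `log Tr exp A`. -/
def logTraceExp (A : Matrix m m ℂ) : ℝ := Real.log (NormedSpace.exp A).trace.re

/-- The Gibbs state `exp (A - log Tr exp A)`. -/
def gibbs (A : Matrix m m ℂ) : Matrix m m ℂ :=
  NormedSpace.exp (A - logTraceExp A • (1 : Matrix m m ℂ))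

omit [Fintype m] in
theorem isHermitian_sub_const {A : Matrix m m ℂ} (hA : A.IsHermitian) (c : ℝ) :
    (A - c • (1 : Matrix m m ℂ)).IsHermitian := by
  refine hA.sub ?_
  rw [Matrix.IsHermitian, Matrix.conjTranspose_smul, Matrix.conjTranspose_one, star_trivial]

theorem trace_gibbs [Nonempty m] {A : Matrix m m ℂ} (hA : A.IsHermitian) :
    (gibbs A).trace.re = 1 := by
  have h := trace_exp_pos hA
  rw [gibbs, exp_sub_const hA, Matrix.trace_smul, Complex.smul_re, logTraceExp, Real.exp_neg,
    Real.exp_log h, smul_eq_mul, inv_mul_cancel₀ h.ne']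

theorem trace_mul_smul_one_re (M : Matrix m m ℂ) (c : ℝ) :
    (M * (c • (1 : Matrix m m ℂ))).trace.re = c * M.trace.re := by
  rw [Matrix.mul_smul, Matrix.mul_one, Matrix.trace_smul, Complex.smul_re, smul_eq_mul]

/-- The gradient inequality for `log Tr exp`, with its case of equality. -/
theorem logTraceExp_gradient [Nonempty m] {A B : Matrix m m ℂ} (hA : A.IsHermitian)
    (hB : B.IsHermitian) :
    logTraceExp A + (gibbs A * (B - A)).trace.re ≤ logTraceExp B ∧
      (logTraceExp A + (gibbs A * (B - A)).trace.re = logTraceExp B →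
        B - A = (logTraceExp B - logTraceExp A) • (1 : Matrix m m ℂ)) := by
  -- With normalized exponents both traces of exponentials are 1 and cancel, leaving only the linear
  -- term.
  obtain ⟨h1, h2⟩ := klein_inequality (isHermitian_sub_const hA (logTraceExp A))
    (isHermitian_sub_const hB (logTraceExp B))
  have hs : B - logTraceExp B • (1 : Matrix m m ℂ) - (A - logTraceExp A • (1 : Matrix m m ℂ)) =
      (B - A) - (logTraceExp B - logTraceExp A) • (1 : Matrix m m ℂ) := by
    rw [sub_smul]; abel
  change (gibbs A).trace.re + (gibbs A * _).trace.re ≤ (gibbs B).trace.re at h1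
  change (gibbs A).trace.re + (gibbs A * _).trace.re = (gibbs B).trace.re → _ at h2
  rw [hs, Matrix.mul_sub, Matrix.trace_sub, Complex.sub_re, trace_mul_smul_one_re,
    trace_gibbs hA, trace_gibbs hB] at h1 h2
  refine ⟨by linarith, fun h => ?_⟩
  have h3 := h2 (by linarith)
  rw [← sub_eq_zero, ← neg_eq_zero, neg_sub, hs, sub_eq_zero] at h3
  exact h3

theorem cfc_log_exp {A : Matrix m m ℂ} (hA : A.IsHermitian) :
    cfc Real.log (NormedSpace.exp A) = A := by
  open scoped Matrix.Norms.L2Operator in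
  exact CFC.log_exp A hA

/-! ### Pure states. -/

/-- Jensen's inequality: the expectation of `A` in a pure state is at most `log Tr exp A`. -/
theorem trace_vecMulVec_mul_le_logTraceExp {A : Matrix m m ℂ} (hA : A.IsHermitian) {ψ : m → ℂ}
    (hψ : dotProduct (star ψ) ψ = 1) :
    (Matrix.vecMulVec ψ (star ψ) * A).trace.re ≤ logTraceExp A := by
  have hne : Nonempty m := by
    by_contra h
    rw [not_nonempty_iff] at h
    simp [dotProduct] at hψ
  have hpos := trace_exp_pos hA
  rw [logTraceExp, Real.le_log_iff_exp_le hpos]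
  obtain ⟨U, hU, a, rfl⟩ := hA.exists_eq_conjDiag
  set p : m → ℝ := fun i => Complex.normSq ((star U).mulVec ψ i) with hp
  have hsum : ∑ i, p i = 1 := by
    have h := trace_vecMulVec_mul_conjDiag (U := U) ψ (fun _ => 1)
    rw [conjDiag_one hU, Matrix.mul_one, Matrix.trace_vecMulVec, dotProduct_comm, hψ] at h
    simp only [one_mul] at h
    exact_mod_cast h.symm
  have hp0 : ∀ i, 0 ≤ p i := fun i => Complex.normSq_nonneg _
  have hp1 : ∀ i, p i ≤ 1 := fun i =>
    hsum ▸ Finset.single_le_sum (f := p) (fun j _ => hp0 j) (Finset.mem_univ i)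
  rw [exp_conjDiag hU, trace_conjDiag hU, trace_vecMulVec_mul_conjDiag, Complex.ofReal_re,
    Complex.ofReal_re]
  set c := ∑ i, a i * p i with hc
  -- The p i are the probabilities of the eigenvectors in the state ψ and c is the mean eigenvalue.
  -- The tangent of exp at c averages to exp c, and p i ≤ 1 removes the weights.
  calc Real.exp c = ∑ i, p i * (Real.exp c + Real.exp c * (a i - c)) := by
        have h : ∀ i, p i * (Real.exp c + Real.exp c * (a i - c)) =
            (Real.exp c - Real.exp c * c) * p i + Real.exp c * (a i * p i) := fun i => by ring
        simp only [h, Finset.sum_add_distrib, ← Finset.mul_sum, hsum, ← hc]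
        ring
    _ ≤ ∑ i, p i * Real.exp (a i) := Finset.sum_le_sum fun i _ =>
        mul_le_mul_of_nonneg_left (exp_tangent_le _ _) (hp0 i)
    _ ≤ ∑ i, Real.exp (a i) := Finset.sum_le_sum fun i _ =>
        mul_le_of_le_one_left (Real.exp_pos _).le (hp1 i)

/-- A Gibbs state is a convex combination of pure states. -/
theorem gibbs_mem_convexHull {n : ℕ} [NeZero n] {A : Matrix (Fin n) (Fin n) ℂ}
    (hA : A.IsHermitian) : gibbs A ∈ convexHull ℝ {ρ | IsPureState ρ} := by
  have h1 := trace_gibbs hA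
  obtain ⟨U, hU, b, hb⟩ := (isHermitian_sub_const hA (logTraceExp A)).exists_eq_conjDiag
  rw [gibbs, hb, exp_conjDiag hU] at h1 ⊢
  rw [trace_conjDiag hU, Complex.ofReal_re] at h1
  rw [conjDiag_eq_sum]
  -- The eigenvalues are positive and sum to the trace 1, so the spectral decomposition is itself a
  -- convex combination.
  refine (convex_convexHull ℝ _).sum_mem (fun i _ => (Real.exp_pos _).le) h1 fun i _ =>
    subset_convexHull ℝ _ ⟨_, ?_, rfl⟩
  have hUU : star U * U = 1 := Unitary.star_mul_self_of_mem hU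
  have := congrFun (congrFun hUU i) i
  rw [Matrix.mul_apply, Matrix.one_apply_eq] at this
  exact this

/-- Each entry of ψψ* has modulus at most 1. Only uniformity in ψ matters: the bound absorbs the
base point θ₀ into a constant. -/
theorem trace_vecMulVec_mul_ge {n : ℕ} (A : Matrix (Fin n) (Fin n) ℂ) {ψ : Fin n → ℂ}
    (hψ : dotProduct (star ψ) ψ = 1) :
    -∑ i, ∑ j, ‖A i j‖ ≤ (Matrix.vecMulVec ψ (star ψ) * A).trace.re := by
  have hsum : ∑ i, ‖ψ i‖ ^ 2 = 1 := by
    have h : dotProduct (star ψ) ψ = ((∑ i, ‖ψ i‖ ^ 2 : ℝ) : ℂ) := by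
      push_cast
      exact Finset.sum_congr rfl fun i _ => by simp [Complex.conj_mul']
    exact_mod_cast h ▸ hψ
  have hle : ∀ i, ‖ψ i‖ ≤ 1 := fun i => by
    have := Finset.single_le_sum (f := fun i => ‖ψ i‖ ^ 2) (fun j _ => sq_nonneg _)
      (Finset.mem_univ i)
    rw [hsum] at this
    exact (sq_le_one_iff₀ (norm_nonneg _)).1 this
  refine neg_le_of_abs_le ((Complex.abs_re_le_norm _).trans ?_)
  rw [Matrix.trace, Finset.sum_comm]
  refine (norm_sum_le _ _).trans (Finset.sum_le_sum fun i _ => ?_)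
  rw [Matrix.diag_apply, Matrix.mul_apply]
  refine (norm_sum_le _ _).trans (Finset.sum_le_sum fun j _ => ?_)
  rw [norm_mul, Matrix.vecMulVec_apply, norm_mul, Pi.star_apply, norm_star]
  exact mul_le_of_le_one_left (norm_nonneg _) (mul_le_one₀ (hle i) (norm_nonneg _) (hle j))

end Matrix

variable {d l k n : ℕ}

/-! ### Gradients of convex functions -/

theorem fderiv_apply_eq_sum (F : (Fin d → ℝ) → ℝ) (θ w : Fin d → ℝ) :
    fderiv ℝ F θ w = ∑ i, w i * partialDeriv F i θ := by
  conv_lhs => rw [pi_eq_sum_univ' w, map_sum]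
  refine Finset.sum_congr rfl fun i _ => ?_
  rw [map_smul, smul_eq_mul, partialDeriv]

theorem partialDeriv_eq_of_isLocalMin {F : (Fin d → ℝ) → ℝ} {x ξ : Fin d → ℝ}
    (hF : DifferentiableAt ℝ F x) (h : IsLocalMin (fun y => F y - ∑ i, ξ i * y i) x)
    (i : Fin d) : partialDeriv F i x = ξ i := by
  let φ : (Fin d → ℝ) →L[ℝ] ℝ := ∑ i, ξ i • ContinuousLinearMap.proj i
  have hφ : ∀ y, φ y = ∑ i, ξ i * y i := fun y => by simp [φ]
  have h1 : HasFDerivAt (fun y => F y - φ y) (fderiv ℝ F x - φ) x :=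
    hF.hasFDerivAt.sub φ.hasFDerivAt
  simp only [hφ] at h1
  have h2 := congrArg (fun T : (Fin d → ℝ) →L[ℝ] ℝ => T (Pi.single i 1)) (h.hasFDerivAt_eq_zero h1)
  simp only [sub_apply, hφ, zero_apply, sub_eq_zero] at h2
  rw [partialDeriv, h2]
  simp [Pi.single_apply]

/-- A differentiable function has at most one subgradient at a point. This lets ∂_j μ be read off
Klein's inequality without differentiating the matrix exponential. -/
theorem partialDeriv_eq_of_subgradient {F : (Fin d → ℝ) → ℝ} {x ξ : Fin d → ℝ}
    (hF : DifferentiableAt ℝ F x) (h : ∀ y, F x + ∑ i, ξ i * (y i - x i) ≤ F y)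
    (i : Fin d) : partialDeriv F i x = ξ i := by
  refine partialDeriv_eq_of_isLocalMin hF (Filter.Eventually.of_forall fun y => ?_) i
  have := h y
  simp only [mul_sub, Finset.sum_sub_distrib] at this
  linarith

/-- The gradient inequality of a differentiable strictly convex function. -/
def StrictGradientIneq (F : (Fin d → ℝ) → ℝ) : Prop :=
  ∀ x y, x ≠ y → F x + ∑ i, partialDeriv F i x * (y i - x i) < F y

/-- Average the gradient inequalities based at the convex combination z; the linear terms cancel. -/
theorem StrictGradientIneq.strictConvexOn {F : (Fin d → ℝ) → ℝ} (h : StrictGradientIneq F) :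
    StrictConvexOn ℝ Set.univ F := by
  refine ⟨convex_univ, fun x _ y _ hxy a b ha hb hab => ?_⟩
  have hb' : b = 1 - a := by linarith
  subst hb'
  have hx : a • x + (1 - a) • y ≠ x := fun he => hxy <| by
    have : (1 - a) • (x - y) = x - (a • x + (1 - a) • y) := by module
    rw [he, sub_self] at this
    exact sub_eq_zero.1 ((smul_eq_zero.1 this).resolve_left hb.ne')
  have hy : a • x + (1 - a) • y ≠ y := fun he => hxy <| by
    have : a • (x - y) = (a • x + (1 - a) • y) - y := by module
    rw [he, sub_self] at this
    exact sub_eq_zero.1 ((smul_eq_zero.1 this).resolve_left ha.ne')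
  set z := a • x + (1 - a) • y with hz
  have h1 := mul_lt_mul_of_pos_left (h z x hx) ha
  have h2 := mul_lt_mul_of_pos_left (h z y hy) hb
  have h3 : a * ∑ i, partialDeriv F i z * (x i - z i) +
      (1 - a) * ∑ i, partialDeriv F i z * (y i - z i) = 0 := by
    rw [Finset.mul_sum, Finset.mul_sum, ← Finset.sum_add_distrib]
    refine Finset.sum_eq_zero fun i _ => ?_
    have : z i = a * x i + (1 - a) * y i := by simp [hz]
    rw [this]; ring
  simp only [smul_eq_mul]
  linarith

/-- The gradient map of a differentiable strictly convex function has open range. -/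
theorem StrictGradientIneq.isOpen_range {F : (Fin d → ℝ) → ℝ} (h : StrictGradientIneq F)
    (hF : Differentiable ℝ F) : IsOpen (Set.range fun x i => partialDeriv F i x) := by
  rw [Metric.isOpen_iff]
  rintro _ ⟨x, rfl⟩
  set g : Fin d → ℝ := fun i => partialDeriv F i x with hg
  let G : (Fin d → ℝ) → (Fin d → ℝ) → ℝ := fun ξ y => F y - ∑ i, ξ i * y i
  have hG : ∀ ξ, Continuous (G ξ) := fun ξ => hF.continuous.sub (by fun_prop)
  -- F minus its tangent at x has a strict minimum at x, so by compactness it exceeds that minimum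
  -- by some ε on the unit sphere. The sphere is empty only for d = 0.
  obtain ⟨ε, hε, hεG⟩ : ∃ ε > 0, ∀ y ∈ Metric.sphere x 1, G g x + ε ≤ G g y := by
    rcases (Metric.sphere x (1 : ℝ)).eq_empty_or_nonempty with he | hne
    · exact ⟨1, one_pos, by simp [he]⟩
    · obtain ⟨y, hy, hmin⟩ := (isCompact_sphere x 1).exists_isMinOn hne (hG g).continuousOn
      refine ⟨G g y - G g x, ?_, fun z hz => by have := hmin hz; simp at this; linarith⟩
      have hxy : x ≠ y := by
        rintro rfl; simp at hy
      have := h x y hxy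
      simp only [mul_sub, Finset.sum_sub_distrib] at this
      simp only [G, hg]
      linarith
  -- In the sup norm, tilting by ξ - g changes the increment from x to the sphere by at most d·ε/(d
  -- + 1) < ε. The minimum over the closed ball therefore stays off the sphere. Using d + 1 also
  -- covers d = 0.
  refine ⟨ε / (d + 1), by positivity, fun ξ hξ => ?_⟩
  obtain ⟨z, hz, hmin⟩ := (isCompact_closedBall x 1).exists_isMinOn
    (Metric.nonempty_closedBall.2 zero_le_one) (hG ξ).continuousOn
  have hzx : G ξ z ≤ G ξ x := hmin (Metric.mem_closedBall_self zero_le_one)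
  have hzball : z ∈ Metric.ball x 1 := by
    rcases (Metric.mem_closedBall.1 hz).lt_or_eq with hlt | heq
    · exact hlt
    · exfalso
      have h1 := hεG z heq
      have h2 : |∑ i, (ξ i - g i) * (z i - x i)| ≤ ∑ _i : Fin d, ε / (d + 1) := by
        refine (Finset.abs_sum_le_sum_abs _ _).trans (Finset.sum_le_sum fun i _ => ?_)
        rw [abs_mul]
        have a1 : |ξ i - g i| ≤ ε / (d + 1) := (dist_le_pi_dist ξ g i).trans hξ.le
        have a2 : |z i - x i| ≤ 1 := (dist_le_pi_dist z x i).trans heq.le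
        calc |ξ i - g i| * |z i - x i| ≤ ε / (d + 1) * 1 :=
              mul_le_mul a1 a2 (abs_nonneg _) (by positivity)
          _ = _ := mul_one _
      have h3 : ∑ _i : Fin d, ε / (d + 1) < ε := by
        rw [Finset.sum_const, Finset.card_univ, Fintype.card_fin, nsmul_eq_mul, mul_div_assoc',
          div_lt_iff₀ (by positivity)]
        nlinarith
      have h4 : ∑ i, (ξ i - g i) * (z i - x i) =
          (∑ i, ξ i * z i - ∑ i, g i * z i) - (∑ i, ξ i * x i - ∑ i, g i * x i) := by
        simp only [← Finset.sum_sub_distrib]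
        exact Finset.sum_congr rfl fun i _ => by ring
      have h5 := (le_abs_self _).trans h2
      simp only [G] at h1 hzx
      linarith
  refine ⟨z, funext fun i => partialDeriv_eq_of_isLocalMin (hF z) ?_ i⟩
  exact hmin.isLocalMin
    (Filter.mem_of_superset (Metric.isOpen_ball.mem_nhds hzball) Metric.ball_subset_closedBall)

/-- Linear growth forces a global minimum of the tilted function, where the gradient of F is ξ. -/
theorem exists_partialDeriv_eq_of_coercive {F : (Fin d → ℝ) → ℝ} (hF : Differentiable ℝ F)
    {ξ : Fin d → ℝ} {c ε : ℝ} (hε : 0 < ε) (h : ∀ y, c + ε * ‖y‖ ≤ F y - ∑ i, ξ i * y i) :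
    ∃ x, (fun i => partialDeriv F i x) = ξ := by
  have hcont : Continuous fun y => F y - ∑ i, ξ i * y i := hF.continuous.sub (by fun_prop)
  obtain ⟨x, hx⟩ := hcont.exists_forall_le (Filter.tendsto_atTop_mono h
    (Filter.tendsto_atTop_add_const_left _ _
      ((tendsto_norm_cocompact_atTop (E := Fin d → ℝ)).const_mul_atTop hε)))
  exact ⟨x, funext fun i => partialDeriv_eq_of_isLocalMin (hF x)
    (Filter.Eventually.of_forall hx) i⟩

/-! ### Exponential subfamilies -/

theorem hasFDerivAt_expParam (θ₀ : Fin d → ℝ) (v : Fin l → Fin d → ℝ) (τ : Fin l → ℝ) :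
    HasFDerivAt (expParam θ₀ v)
      (∑ j, (ContinuousLinearMap.proj j : (Fin l → ℝ) →L[ℝ] ℝ).smulRight (v j)) τ := by
  refine HasFDerivAt.const_add θ₀ (HasFDerivAt.fun_sum fun j _ => ?_)
  exact ((ContinuousLinearMap.proj j : (Fin l → ℝ) →L[ℝ] ℝ).smulRight (v j)).hasFDerivAt

theorem differentiable_expPotential {F : (Fin d → ℝ) → ℝ} (hF : Differentiable ℝ F)
    (θ₀ : Fin d → ℝ) (v : Fin l → Fin d → ℝ) : Differentiable ℝ (expPotential F θ₀ v) :=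
  hF.comp fun τ => (hasFDerivAt_expParam θ₀ v τ).differentiableAt

theorem partialDeriv_expPotential {F : (Fin d → ℝ) → ℝ} (hF : Differentiable ℝ F)
    (θ₀ : Fin d → ℝ) (v : Fin l → Fin d → ℝ) (j : Fin l) (τ : Fin l → ℝ) :
    partialDeriv (expPotential F θ₀ v) j τ =
      ∑ i, v j i * partialDeriv F i (expParam θ₀ v τ) := by
  have h : HasFDerivAt (expPotential F θ₀ v) _ τ :=
    (hF (expParam θ₀ v τ)).hasFDerivAt.comp τ (hasFDerivAt_expParam θ₀ v τ)
  rw [partialDeriv, h.fderiv, ← fderiv_apply_eq_sum]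
  simp [Pi.single_apply]

theorem expParam_injective (θ₀ : Fin d → ℝ) {v : Fin l → Fin d → ℝ}
    (hv : LinearIndependent ℝ v) : Function.Injective (expParam θ₀ v) := fun σ τ h => by
  rw [Fintype.linearIndependent_iff] at hv
  have h1 : ∑ j, (σ j - τ j) • v j = 0 := by
    simp only [sub_smul, Finset.sum_sub_distrib]
    exact sub_eq_zero.2 (add_left_cancel h)
  exact funext fun j => sub_eq_zero.1 (hv _ h1 j)

theorem StrictGradientIneq.expPotential {F : (Fin d → ℝ) → ℝ} (h : StrictGradientIneq F)
    (hF : Differentiable ℝ F) (θ₀ : Fin d → ℝ) {v : Fin l → Fin d → ℝ}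
    (hv : LinearIndependent ℝ v) : StrictGradientIneq (expPotential F θ₀ v) := by
  intro σ τ hne
  refine lt_of_eq_of_lt (congrArg (F (expParam θ₀ v σ) + ·) ?_)
    (h _ _ ((expParam_injective θ₀ hv).ne hne))
  simp only [partialDeriv_expPotential hF, Finset.sum_mul]
  rw [Finset.sum_comm]
  refine Finset.sum_congr rfl fun i _ => ?_
  have : expParam θ₀ v τ i - expParam θ₀ v σ i = ∑ j, (τ j - σ j) * v j i := by
    simp [expParam, sub_mul, Finset.sum_sub_distrib]
  rw [this, Finset.mul_sum]
  exact Finset.sum_congr rfl fun j _ => by ring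

/-! ### Mixture subfamilies: from (M3) to (E3). -/

/-- Fixing the u-coordinates τ leaves the exponential subfamily through ∑ τ^i u_i in the directions
v, and its mixture parameters are exactly the constraint values in M(a). -/
theorem mem_mixtureNaturalSet_iff {F : (Fin d → ℝ) → ℝ} (hF : Differentiable ℝ F)
    (u : Fin k → Fin d → ℝ) (v : Fin l → Fin d → ℝ) (a : Fin l → ℝ) (τ : Fin k → ℝ) :
    τ ∈ mixtureNaturalSet Set.univ F u v a ↔
      a ∈ expMixtureSet Set.univ F (∑ i, τ i • u i) v := by
  constructor
  · rintro ⟨σ, -, h⟩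
    exact ⟨σ, trivial, funext fun j => (partialDeriv_expPotential hF _ v j σ).trans (h j)⟩
  · rintro ⟨σ, -, h⟩
    exact ⟨σ, trivial, fun j =>
      (partialDeriv_expPotential hF _ v j σ).symm.trans (congrFun h j)⟩

/-- Condition (M3) on `ℝ^d` implies condition (E3). -/
theorem CondM3.condE3 {F : (Fin d → ℝ) → ℝ} (hF : Differentiable ℝ F) {v : Fin l → Fin d → ℝ}
    (h : CondM3 Set.univ F v) : CondE3 Set.univ F v := by
  have key : ∀ (u : Fin (d - l) → Fin d → ℝ) (a : Fin l → ℝ),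
      (mixtureFamily Set.univ F v a).Nonempty → mixtureNaturalSet Set.univ F u v a = Set.univ := by
    rintro u a ⟨θ, -, hθ⟩
    -- A point θ of M(a) realizes a in the subfamily through θ; by (M3) a is then realized through
    -- every base point.
    refine Set.eq_univ_of_forall fun τ => (mem_mixtureNaturalSet_iff hF u v a τ).2 ?_
    rw [h _ trivial θ trivial]
    refine ⟨0, trivial, funext fun j => ?_⟩
    rw [← hθ j]
    exact (partialDeriv_expPotential hF θ v j 0).trans (by simp [expParam])
  intro u _ a b ha hb
  rw [key u a ha, key u b hb]

/-! ### The quantum system -/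

theorem isHermitian_sum_smul {X : Fin d → Matrix (Fin n) (Fin n) ℂ} (hX : ∀ j, (X j).IsHermitian)
    (θ : Fin d → ℝ) : (∑ j, θ j • X j).IsHermitian := by
  rw [Matrix.IsHermitian, Matrix.conjTranspose_sum]
  exact Finset.sum_congr rfl fun j _ => by
    rw [Matrix.conjTranspose_smul, (hX j).eq, star_trivial]

theorem trace_mul_sum_smul_re (M : Matrix (Fin n) (Fin n) ℂ)
    (X : Fin d → Matrix (Fin n) (Fin n) ℂ) (c : Fin d → ℝ) :
    (M * ∑ j, c j • X j).trace.re = ∑ j, c j * (M * X j).trace.re := by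
  simp [Matrix.mul_sum, Matrix.trace_sum, Matrix.trace_smul]

theorem contDiff_quantumPotential [NeZero n] {X : Fin d → Matrix (Fin n) (Fin n) ℂ}
    (hX : ∀ j, (X j).IsHermitian) : ContDiff ℝ ∞ (quantumPotential X) := by
  open scoped Matrix.Norms.Operator in
  have hexp : ContDiff ℝ ∞ (NormedSpace.exp : Matrix (Fin n) (Fin n) ℂ → _) :=
    contDiff_iff_contDiffAt.2 fun x => (NormedSpace.exp_analytic (𝕂 := ℝ) x).contDiffAt
  have htr : ContDiff ℝ ∞ (fun M : Matrix (Fin n) (Fin n) ℂ => M.trace.re) :=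
    (Complex.reLm ∘ₗ Matrix.traceLinearMap (Fin n) ℝ ℂ).toContinuousLinearMap.contDiff
  have hlin : ContDiff ℝ ∞ (fun θ : Fin d → ℝ => ∑ j, θ j • X j) := by fun_prop
  exact (htr.comp (hexp.comp hlin)).log fun θ => (trace_exp_pos (isHermitian_sum_smul hX θ)).ne'

theorem quantumPotential_gradient [NeZero n] {X : Fin d → Matrix (Fin n) (Fin n) ℂ}
    (hX : ∀ j, (X j).IsHermitian) (θ θ' : Fin d → ℝ) :
    quantumPotential X θ + ∑ j, (quantumState X θ * X j).trace.re * (θ' j - θ j) ≤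
        quantumPotential X θ' ∧
      (quantumPotential X θ + ∑ j, (quantumState X θ * X j).trace.re * (θ' j - θ j) =
        quantumPotential X θ' → ∃ c : ℝ, ∑ j, (θ' j - θ j) • X j = c • 1) := by
  have h := logTraceExp_gradient (isHermitian_sum_smul hX θ) (isHermitian_sum_smul hX θ')
  have hs : ∑ j, θ' j • X j - ∑ j, θ j • X j = ∑ j, (θ' j - θ j) • X j := by
    simp only [sub_smul, Finset.sum_sub_distrib]
  rw [hs, trace_mul_sum_smul_re] at h
  simp only [mul_comm ((quantumState X θ * X _).trace.re)]
  exact ⟨h.1, fun he => ⟨_, h.2 he⟩⟩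

theorem partialDeriv_quantumPotential [NeZero n] {X : Fin d → Matrix (Fin n) (Fin n) ℂ}
    (hX : ∀ j, (X j).IsHermitian) (θ : Fin d → ℝ) (j : Fin d) :
    partialDeriv (quantumPotential X) j θ = (quantumState X θ * X j).trace.re :=
  partialDeriv_eq_of_subgradient (ξ := fun j => (quantumState X θ * X j).trace.re)
    ((contDiff_quantumPotential hX).differentiable (by simp) θ)
    (fun θ' => (quantumPotential_gradient hX θ θ').1) j

/-- Equality would make ∑ (θ'_j - θ_j) X_j equal to c I. Independence excludes c = 0, and I outside
the span excludes c ≠ 0. -/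
theorem strictGradientIneq_quantumPotential [NeZero n] {X : Fin d → Matrix (Fin n) (Fin n) ℂ}
    (hX : ∀ j, (X j).IsHermitian) (hind : LinearIndependent ℝ X)
    (hone : (1 : Matrix (Fin n) (Fin n) ℂ) ∉ Submodule.span ℝ (Set.range X)) :
    StrictGradientIneq (quantumPotential X) := by
  intro θ θ' hne
  simp only [partialDeriv_quantumPotential hX]
  obtain ⟨hle, heq⟩ := quantumPotential_gradient hX θ θ'
  refine lt_of_le_of_ne hle fun he => ?_
  obtain ⟨c, hc⟩ := heq he
  rcases eq_or_ne c 0 with rfl | hc0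
  · rw [zero_smul] at hc
    exact hne (funext fun j =>
      (sub_eq_zero.1 (Fintype.linearIndependent_iff.1 hind _ hc j)).symm)
  · refine hone ?_
    have h1 : (1 : Matrix (Fin n) (Fin n) ℂ) = c⁻¹ • ∑ j, (θ' j - θ j) • X j := by
      rw [hc, smul_smul, inv_mul_cancel₀ hc0, one_smul]
    rw [h1]
    exact Submodule.smul_mem _ _ (Submodule.sum_mem _ fun j _ =>
      Submodule.smul_mem _ _ (Submodule.subset_span ⟨j, rfl⟩))

theorem relativeEntropy_quantumState [NeZero n] {X : Fin d → Matrix (Fin n) (Fin n) ℂ}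
    (hX : ∀ j, (X j).IsHermitian) (θ θ' : Fin d → ℝ) :
    relativeEntropy (quantumState X θ) (quantumState X θ') =
      divergence (quantumPotential X) θ θ' := by
  have h1 : (quantumState X θ).trace.re = 1 := trace_gibbs (isHermitian_sum_smul hX θ)
  have hs : ∑ j, θ j • X j - quantumPotential X θ • (1 : Matrix (Fin n) (Fin n) ℂ) -
      (∑ j, θ' j • X j - quantumPotential X θ' • (1 : Matrix (Fin n) (Fin n) ℂ)) =
      ∑ j, (θ j - θ' j) • X j -
        (quantumPotential X θ - quantumPotential X θ') • (1 : Matrix (Fin n) (Fin n) ℂ) := by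
    simp only [sub_smul, Finset.sum_sub_distrib]
    abel
  have hlog : ∀ θ, cfc Real.log (quantumState X θ) = ∑ j, θ j • X j - quantumPotential X θ • 1 :=
    fun θ => cfc_log_exp (isHermitian_sub_const (isHermitian_sum_smul hX θ) _)
  rw [relativeEntropy, hlog, hlog, hs, Matrix.mul_sub, Matrix.trace_sub, Complex.sub_re,
    trace_mul_sum_smul_re, trace_mul_smul_one_re, h1, divergence]
  simp only [partialDeriv_quantumPotential hX, mul_comm (θ _ - θ' _)]
  ring

theorem isSystem_quantumPotential [NeZero n] {X : Fin d → Matrix (Fin n) (Fin n) ℂ}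
    (hX : ∀ j, (X j).IsHermitian) (hind : LinearIndependent ℝ X)
    (hone : (1 : Matrix (Fin n) (Fin n) ℂ) ∉ Submodule.span ℝ (Set.range X)) :
    IsSystem Set.univ (quantumPotential X)
      (fun θ θ' => relativeEntropy (quantumState X θ) (quantumState X θ')) where
  isOpen := isOpen_univ
  convex := convex_univ
  smooth := (contDiff_quantumPotential hX).contDiffOn
  strictConvex := (strictGradientIneq_quantumPotential hX hind hone).strictConvexOn
  divergence_eq θ _ θ' _ := relativeEntropy_quantumState hX θ θ'

/-! ### Mixture parameters of exponential subfamilies -/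

/-- Mixture parameters are the image of a Gibbs state under the linear map ρ ↦ (Tr ρ Y_j)_j, and
linear maps commute with convex hulls. -/
theorem partialDeriv_expPotential_mem_convexHull [NeZero n]
    {X : Fin d → Matrix (Fin n) (Fin n) ℂ} (hX : ∀ j, (X j).IsHermitian) (θ₀ : Fin d → ℝ)
    (v : Fin l → Fin d → ℝ) (τ : Fin l → ℝ) :
    (fun j => partialDeriv (expPotential (quantumPotential X) θ₀ v) j τ) ∈
      convexHull ℝ (pureExpectations fun j => ∑ i, v j i • X i) := by
  let L : Matrix (Fin n) (Fin n) ℂ →ₗ[ℝ] Fin l → ℝ :=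
    { toFun := fun ρ j => (ρ * ∑ i, v j i • X i).trace.re
      map_add' := fun ρ σ => by ext j; simp [Matrix.add_mul]
      map_smul' := fun c ρ => by ext j; simp [Matrix.trace_smul] }
  have hL : convexHull ℝ (pureExpectations fun j => ∑ i, v j i • X i) =
      L '' convexHull ℝ {ρ | IsPureState ρ} := (L.image_convexHull _).symm
  rw [hL]
  refine ⟨_, gibbs_mem_convexHull (isHermitian_sum_smul hX (expParam θ₀ v τ)), funext fun j => ?_⟩
  rw [partialDeriv_expPotential ((contDiff_quantumPotential hX).differentiable (by simp))]
  simp only [partialDeriv_quantumPotential hX]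
  exact trace_mul_sum_smul_re _ _ _

/-- For a pure state this is Jensen's inequality plus the uniform bound on the θ₀ term. The
condition on x defines a half-space, so it passes to the convex hull. -/
theorem quantumPotential_expParam_ge {X : Fin d → Matrix (Fin n) (Fin n) ℂ}
    (hX : ∀ j, (X j).IsHermitian) (θ₀ : Fin d → ℝ) (v : Fin l → Fin d → ℝ) (τ : Fin l → ℝ)
    {x : Fin l → ℝ} (hx : x ∈ convexHull ℝ (pureExpectations fun j => ∑ i, v j i • X i)) :
    -∑ i, ∑ j, ‖(∑ k, θ₀ k • X k) i j‖ + ∑ j, τ j * x j ≤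
      quantumPotential X (expParam θ₀ v τ) := by
  have hconv : Convex ℝ {x : Fin l → ℝ | ∑ j, τ j * x j ≤
      quantumPotential X (expParam θ₀ v τ) + ∑ i, ∑ j, ‖(∑ k, θ₀ k • X k) i j‖} := by
    refine convex_halfSpace_le ⟨fun x y => ?_, fun c x => ?_⟩ _
    · simp [mul_add, Finset.sum_add_distrib]
    · simp only [Pi.smul_apply, smul_eq_mul, Finset.mul_sum]
      exact Finset.sum_congr rfl fun j _ => by ring
  have := convexHull_min ?_ hconv hx
  · have h : ∑ j, τ j * x j ≤ _ := this
    linarith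
  · rintro _ ⟨_, ⟨ψ, hψ, rfl⟩, rfl⟩
    have h1 := trace_vecMulVec_mul_le_logTraceExp (isHermitian_sum_smul hX (expParam θ₀ v τ)) hψ
    have h2 := trace_vecMulVec_mul_ge (∑ k, θ₀ k • X k) hψ
    have hs : ∑ i, expParam θ₀ v τ i • X i =
        ∑ k, θ₀ k • X k + ∑ j, τ j • ∑ i, v j i • X i := by
      simp only [expParam, Pi.add_apply, add_smul, Finset.sum_add_distrib, Finset.sum_apply,
        Pi.smul_apply, smul_eq_mul, Finset.sum_smul, Finset.smul_sum, smul_smul]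
      rw [Finset.sum_comm]
    rw [hs, Matrix.mul_add, Matrix.trace_add, Complex.add_re,
      trace_mul_sum_smul_re _ (fun j => ∑ i, v j i • X i) τ, ← hs] at h1
    change _ ≤ quantumPotential X (expParam θ₀ v τ) at h1
    change ∑ j, τ j * _ ≤ _
    linarith

/-- The set of mixture parameters of an exponential subfamily is the interior of the convex hull
of the expectations in pure states. -/
theorem expMixtureSet_quantumPotential [NeZero n] {X : Fin d → Matrix (Fin n) (Fin n) ℂ}
    (hX : ∀ j, (X j).IsHermitian) (hind : LinearIndependent ℝ X)
    (hone : (1 : Matrix (Fin n) (Fin n) ℂ) ∉ Submodule.span ℝ (Set.range X))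
    (θ₀ : Fin d → ℝ) {v : Fin l → Fin d → ℝ} (hv : LinearIndependent ℝ v) :
    expMixtureSet Set.univ (quantumPotential X) θ₀ v =
      interior (convexHull ℝ (pureExpectations fun j => ∑ i, v j i • X i)) := by
  have hF := (contDiff_quantumPotential hX).differentiable (by simp)
  have hE := differentiable_expPotential hF θ₀ v
  apply Set.Subset.antisymm
  · have himg : expMixtureSet Set.univ (quantumPotential X) θ₀ v =
        Set.range fun τ j => partialDeriv (expPotential (quantumPotential X) θ₀ v) j τ :=
      Set.image_univ
    rw [himg]
    refine interior_maximal ?_ (((strictGradientIneq_quantumPotential hX hind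
      hone).expPotential hF θ₀ hv).isOpen_range hE)
    rintro _ ⟨τ, rfl⟩
    exact partialDeriv_expPotential_mem_convexHull hX θ₀ v τ
  · intro ξ hξ
    obtain ⟨ε, hε, hball⟩ := Metric.nhds_basis_closedBall.mem_iff.1 (mem_interior_iff_mem_nhds.1 hξ)
    obtain ⟨τ, hτ⟩ := exists_partialDeriv_eq_of_coercive hE (ξ := ξ)
      (c := -∑ i, ∑ j, ‖(∑ k, θ₀ k • X k) i j‖) hε fun τ => by
        -- Moving ξ by ε times the sign vector of τ stays in the sup-norm ball and gains ε times the
        -- ℓ¹ norm of τ, which dominates ε‖τ‖.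
        let s : Fin l → ℝ := fun j => ε * SignType.sign (τ j)
        have hs : ξ + s ∈ Metric.closedBall ξ ε := by
          rw [mem_closedBall_iff_norm, add_sub_cancel_left, pi_norm_le_iff_of_nonneg hε.le]
          intro j
          rw [norm_mul, Real.norm_of_nonneg hε.le]
          refine mul_le_of_le_one_right hε.le ?_
          rcases lt_trichotomy (τ j) 0 with h | h | h <;> simp [h]
        have h1 := quantumPotential_expParam_ge hX θ₀ v τ (hball hs)
        have h2 : ε * ‖τ‖ ≤ ∑ j, τ j * s j := by
          have hj : ∀ j, τ j * s j = ε * |τ j| := fun j => by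
            rw [← self_mul_sign (τ j)]; ring
          simp only [hj, ← Finset.mul_sum]
          refine mul_le_mul_of_nonneg_left ?_ hε.le
          rw [pi_norm_le_iff_of_nonneg (Finset.sum_nonneg fun j _ => abs_nonneg _)]
          exact fun j => Finset.single_le_sum (f := fun j => |τ j|) (fun j _ => abs_nonneg _)
            (Finset.mem_univ j)
        have h3 : ∑ j, τ j * (ξ + s) j = ∑ j, ξ j * τ j + ∑ j, τ j * s j := by
          rw [← Finset.sum_add_distrib]
          exact Finset.sum_congr rfl fun j _ => by rw [Pi.add_apply]; ring
        change _ ≤ quantumPotential X (expParam θ₀ v τ) - _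
        linarith
    exact ⟨τ, trivial, hτ⟩

end Bregman

end

theorem mainTheorem11 {n d : ℕ} (X : Fin d → Matrix (Fin n) (Fin n) ℂ)
    (hX : ∀ j, (X j).IsHermitian) (hind : LinearIndependent ℝ X)
    (hone : (1 : Matrix (Fin n) (Fin n) ℂ) ∉ Submodule.span ℝ (Set.range X)) :
    Bregman.IsSystem Set.univ (Bregman.quantumPotential X)
        (fun θ θ' => Bregman.relativeEntropy (Bregman.quantumState X θ)
          (Bregman.quantumState X θ')) ∧
      Bregman.CondE4 Set.univ (Bregman.quantumPotential X) ∧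
      Bregman.CondM4 Set.univ (Bregman.quantumPotential X) ∧
      (∀ (θ : Fin d → ℝ) (j : Fin d),
        Bregman.partialDeriv (Bregman.quantumPotential X) j θ =
          (Bregman.quantumState X θ * X j).trace.re) ∧
      (∀ (l : ℕ) (θ₀ : Fin d → ℝ) (v : Fin l → Fin d → ℝ), LinearIndependent ℝ v →
        Bregman.expMixtureSet Set.univ (Bregman.quantumPotential X) θ₀ v =
          interior (convexHull ℝ
            (Bregman.pureExpectations fun j => ∑ i, v j i • X i))) := by
  -- For n = 0 the identity is 0, hence in every span.
  have hn : NeZero n := ⟨by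
    rintro rfl
    exact hone (Subsingleton.elim (0 : Matrix (Fin 0) (Fin 0) ℂ) 1 ▸ Submodule.zero_mem _)⟩
  have hM : ∀ (l : ℕ) (v : Fin l → Fin d → ℝ), LinearIndependent ℝ v →
      Bregman.CondM3 Set.univ (Bregman.quantumPotential X) v := fun l v hv θ₀ _ θ₁ _ => by
    rw [Bregman.expMixtureSet_quantumPotential hX hind hone θ₀ hv,
      Bregman.expMixtureSet_quantumPotential hX hind hone θ₁ hv]
  exact ⟨Bregman.isSystem_quantumPotential hX hind hone,
    fun l _ _ v hv => (hM l v hv).condE3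
      ((Bregman.contDiff_quantumPotential hX).differentiable (by simp)),
    fun l _ _ v hv => hM l v hv,
    Bregman.partialDeriv_quantumPotential hX,
    fun l θ₀ v hv => Bregman.expMixtureSet_quantumPotential hX hind hone θ₀ hv⟩
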